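/- Let $B$ be a separable real Banach space. Write $\mathcal P_1(B)$ for the Borel probability measures on $B$ with finite first moment and $\mathcal W_1$ for the $1$-Wasserstein distance. For $\mu,\nu\in\mathcal P_1(B)$ let $\mathcal M(\mu,\nu)$ be the set of martingale couplings, i.e. of the probability measures $\pi$ on $B\times B$ with marginals $\mu,\nu$ such that $\int g(x)(y-x)\,d\pi(x,y)=0$ for all bounded continuous $g:B\to\mathbb R$. Let $c:B\times B\to[0,\infty)$ be continuous with sub-linear growth, i.e. $c(x,y)\le C(1+\|x\|+\|y\|)$ for some constant $C$. Define $$\mathbb E^{\pi}[c]=\int c\,d\pi,\qquad P(\mu,\nu)=\inf_{\pi\in\mathcal M(\mu,\nu)}\mathbb E^{\pi}[c].$$ Let $\mu,\nu\in\mathcal P_1(B)$, $\tilde\pi\in\mathcal M(\mu,\nu)$ and $P=P(\mu,\nu)$. (1) Let $\mu_n,\nu_n\in\mathcal P_1(B)$ with $\mathcal W_1(\mu_n,\mu)\to0$ and $\mathcal W_1(\nu_n,\nu)\to0$, and let $\pi_n\in\mathcal M(\mu_n,\nu_n)$ converge weakly to $\tilde\pi$. Put $P_n=P(\mu_n,\nu_n)$.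 Then $$\mathbb E^{\tilde\pi}[c]\ \ge\ \limsup_n P_n\ \ge\ \liminf_n P_n\ \ge\ P .$$ If moreover $\tilde\pi$ is an optimiser, i.e. $\mathbb E^{\tilde\pi}[c]\le\mathbb E^{\pi}[c]$ for all $\pi\in\mathcal M(\mu,\nu)$, then $P_n\to P$. (2) In particular, the conclusions of (1) hold for martingale quantisations: let $X,Y$ be $B$-valued random variables on a probability space with joint law $\tilde\pi$; for $i=1,2$ let $(\Pi_i^n)_{n\in\mathbb N}$ be finite Borel partitions of $B$ with $\sigma(\Pi_i^n)\subseteq\sigma(\Pi_i^{n+1})$ for all $n$ and $\sigma(\bigcup_n\Pi_i^n)=\mathcal B(B)$; and let $\mu_n,\nu_n$ be the laws of $$X_n=\mathbb E\big[X\,\big|\,\sigma(X^{-1}(\Pi_1^n))\big],\qquad Y_n=\mathbb E\big[Y\,\big|\,\sigma(X^{-1}(\Pi_1^n))\vee\sigma(Y^{-1}(\Pi_2^n))\big].$$ -/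

import Mathlib

open MeasureTheory Filter Topology
open scoped NNReal ENNReal BoundedContinuousFunction

namespace MOT

/-- Finite first moment: a probability measure with this property is an element of `𝒫₁(B)`. -/
def FiniteFirstMoment {B : Type*} [NormedAddCommGroup B] [MeasurableSpace B]
    (μ : Measure B) : Prop :=
  ∫⁻ x, ‖x‖ₑ ∂μ < ∞

/-- The set `Π(μ, ν)` of transport plans (couplings) from `μ` to `ν`. -/
def couplings {B : Type*} [MeasurableSpace B] (μ ν : Measure B) : Set (Measure (B × B)) :=
  {π | π.map Prod.fst = μ ∧ π.map Prod.snd = ν}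

/-- The `1`-Wasserstein distance, with values in `[0, ∞]`. -/
noncomputable def W1 {B : Type*} [NormedAddCommGroup B] [MeasurableSpace B]
    (μ ν : Measure B) : ℝ≥0∞ :=
  ⨅ π ∈ couplings μ ν, ∫⁻ p, edist p.1 p.2 ∂π

/-- The set `ℳ(μ, ν)` of martingale couplings: the couplings `π` with
`∫ g(x) (y - x) dπ(x, y) = 0` for all bounded continuous `g : B → ℝ`. The (Bochner) integrand is
integrable whenever `μ` and `ν` have finite first moments. -/
def martingaleCouplings {B : Type*} [NormedAddCommGroup B] [NormedSpace ℝ B] [MeasurableSpace B]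
    (μ ν : Measure B) : Set (Measure (B × B)) :=
  {π | π ∈ couplings μ ν ∧ ∀ g : B →ᵇ ℝ, ∫ p, g p.1 • (p.2 - p.1) ∂π = 0}

/-- The expected cost `𝔼^π[c(X, Y)]` of a non-negative cost function. -/
noncomputable def cost {B : Type*} [MeasurableSpace B] (c : B × B → ℝ≥0)
    (π : Measure (B × B)) : ℝ≥0∞ :=
  ∫⁻ p, (c p : ℝ≥0∞) ∂π

/-- The value of the martingale optimal transport problem: the infimum of the expected cost over
the martingale couplings (`∞` if there are none). -/
noncomputable def value {B : Type*} [NormedAddCommGroup B] [NormedSpace ℝ B] [MeasurableSpace B]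
    (c : B × B → ℝ≥0) (μ ν : Measure B) : ℝ≥0∞ :=
  ⨅ π ∈ martingaleCouplings μ ν, cost c π

/-- `π` is an optimiser of the martingale optimal transport problem between `μ` and `ν`. -/
def IsOptimiser {B : Type*} [NormedAddCommGroup B] [NormedSpace ℝ B] [MeasurableSpace B]
    (c : B × B → ℝ≥0) (μ ν : Measure B) (π : Measure (B × B)) : Prop :=
  π ∈ martingaleCouplings μ ν ∧ ∀ π' ∈ martingaleCouplings μ ν, cost c π ≤ cost c π'

/-- Sub-linear growth: `|c(x, y)| ≤ C (1 + ‖x‖ + ‖y‖)`. -/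
def SublinearGrowth {B : Type*} [NormedAddCommGroup B] (c : B × B → ℝ≥0) : Prop :=
  ∃ C : ℝ, ∀ x y : B, (c (x, y) : ℝ) ≤ C * (1 + ‖x‖ + ‖y‖)

/-- A sequence of finite partitions of `B` into measurable sets (empty pieces allowed), each
refining the previous one, which together generate the σ-algebra of `B`. -/
structure IsGeneratingPartitions {B : Type*} [MeasurableSpace B] (Q : ℕ → Set (Set B)) :
    Prop where
  finite : ∀ n, (Q n).Finite
  measurableSet : ∀ n, ∀ A ∈ Q n, MeasurableSet A
  partition : ∀ n, ∀ x : B, ∃! A : Set B, A ∈ Q n ∧ x ∈ A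
  refine_succ : ∀ n,
    MeasurableSpace.generateFrom (Q n) ≤ MeasurableSpace.generateFrom (Q (n + 1))
  generate : MeasurableSpace.generateFrom (⋃ n, Q n) = ‹MeasurableSpace B›

/-- The σ-algebra `σ(X⁻¹(Q))` on `Ω` generated by the preimages under `X` of the sets in `Q`. -/
abbrev preimageSigma {Ω B : Type*} (X : Ω → B) (Q : Set (Set B)) : MeasurableSpace Ω :=
  MeasurableSpace.generateFrom ((fun A => X ⁻¹' A) '' Q)

/-- First component `X_n = 𝔼[X | σ(X⁻¹(Q₁ⁿ))]` of the martingale quantisation of `(X, Y)`. -/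
noncomputable def quantX {Ω B : Type*} [MeasurableSpace Ω] [NormedAddCommGroup B]
    [NormedSpace ℝ B] [CompleteSpace B] (P : Measure Ω) (X : Ω → B) (Q₁ : Set (Set B)) : Ω → B :=
  P[X | preimageSigma X Q₁]

/-- Second component `Y_n = 𝔼[Y | σ(X⁻¹(Q₁ⁿ)) ∨ σ(Y⁻¹(Q₂ⁿ))]` of the martingale quantisation of
`(X, Y)`. -/
noncomputable def quantY {Ω B : Type*} [MeasurableSpace Ω] [NormedAddCommGroup B]
    [NormedSpace ℝ B] [CompleteSpace B] (P : Measure Ω) (X Y : Ω → B) (Q₁ Q₂ : Set (Set B)) :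
    Ω → B :=
  P[Y | preimageSigma X Q₁ ⊔ preimageSigma Y Q₂]

end MOT

/-! Two opposite semicontinuities give the chain of inequalities. From above, `π_n` competes in the
problem for `(μ_n, ν_n)`, so `P_n` is at most its cost, and this cost converges to that of `π̃`.
Weak convergence alone does not control a cost of linear growth, but `W1` convergence of the
marginals makes the integrals of `1 + ‖x‖ + ‖y‖` converge, and a continuous function dominated by
one whose integrals converge has convergent integrals itself (`tendsto_integral_of_abs_le`).

From below (`value_le_liminf`), near-optimal couplings are tight because their marginals are. By
Prokhorov they have a cluster point, which is again a martingale coupling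
(`mem_martingaleCouplings_of_tendsto`), and the cost is weakly lower semicontinuous. If `π̃` is
optimal, both ends of the chain equal `P`.

For quantisations, Lévy's upward theorem (`tendsto_eLpNorm_condExp_sub`) gives `X_n → X` and `Y_n →
Y` in `L¹`, hence `W1` convergence of the marginals and weak convergence of the joint laws. The
tower property makes the law of `(X_n, Y_n)` a martingale coupling
(`map_condExp_mem_martingaleCouplings`), so the first part applies. -/

namespace MOT

/-! ### Weak convergence and unbounded continuous integrands. -/

section Weak

variable {Ω ι : Type*} [MeasurableSpace Ω] [TopologicalSpace Ω] [OpensMeasurableSpace Ω]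
  {l : Filter ι} {μs : ι → ProbabilityMeasure Ω} {μ : ProbabilityMeasure Ω}

/-- The integral of a non-negative continuous function is lower semicontinuous with respect to weak
convergence. -/
theorem eventually_lt_lintegral (h : Tendsto μs l (𝓝 μ)) {f : Ω → ℝ≥0} (hf : Continuous f)
    {a : ℝ≥0∞} (ha : a < ∫⁻ x, f x ∂(μ : Measure Ω)) :
    ∀ᶠ i in l, a < ∫⁻ x, f x ∂(μs i : Measure Ω) := by
  -- By monotone convergence some truncation of `f` already has integral above `a`, and weak
  -- convergence applies to that bounded function.
  let g : ℕ → Ω →ᵇ ℝ≥0 := fun k =>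
    BoundedContinuousFunction.mkOfBound ⟨fun x => min (f x) k, by fun_prop⟩ k (fun x y => by
      have hx : ((min (f x) k : ℝ≥0) : ℝ) ≤ k := by exact_mod_cast min_le_right _ _
      have hy : ((min (f y) k : ℝ≥0) : ℝ) ≤ k := by exact_mod_cast min_le_right _ _
      have hx' : (0 : ℝ) ≤ (min (f x) k : ℝ≥0) := NNReal.coe_nonneg _
      have hy' : (0 : ℝ) ≤ (min (f y) k : ℝ≥0) := NNReal.coe_nonneg _
      simp only [ContinuousMap.coe_mk, NNReal.dist_eq, abs_le]
      constructor <;> linarith)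
  have hg : ∀ k x, g k x = min (f x) k := fun k x => rfl
  have hlim : Tendsto (fun k => ∫⁻ x, (g k x : ℝ≥0∞) ∂(μ : Measure Ω)) atTop
      (𝓝 (∫⁻ x, f x ∂(μ : Measure Ω))) := by
    refine lintegral_tendsto_of_tendsto_of_monotone
      (fun k => (g k).continuous.measurable.coe_nnreal_ennreal.aemeasurable) ?_ ?_
    · refine ae_of_all _ fun x i j hij => ?_
      simp only [hg]
      gcongr
    · refine ae_of_all _ fun x => tendsto_const_nhds.congr' ?_
      obtain ⟨N, hN⟩ := exists_nat_ge (f x)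
      filter_upwards [eventually_ge_atTop N] with k hk
      rw [hg, min_eq_left (hN.trans (by exact_mod_cast hk))]
  obtain ⟨k, hk⟩ := (hlim.eventually_const_lt ha).exists
  have := ProbabilityMeasure.tendsto_iff_forall_lintegral_tendsto.1 h (g k)
  filter_upwards [this.eventually_const_lt hk] with i hi
  refine hi.trans_le (lintegral_mono fun x => ?_)
  rw [hg]
  exact ENNReal.coe_le_coe.2 (min_le_left _ _)

theorem lintegral_le_liminf (h : Tendsto μs l (𝓝 μ)) {f : Ω → ℝ≥0} (hf : Continuous f) :
    ∫⁻ x, f x ∂(μ : Measure Ω) ≤ liminf (fun i => ∫⁻ x, f x ∂(μs i : Measure Ω)) l :=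
  le_of_forall_lt fun _ ha =>
    let ⟨_, hb, hb'⟩ := exists_between ha
    hb.trans_le (le_liminf_of_le (by isBoundedDefault)
      ((eventually_lt_lintegral h hf hb').mono fun _ hi => hi.le))

theorem eventually_lt_integral (h : Tendsto μs l (𝓝 μ)) {f : Ω → ℝ} (hf : Continuous f)
    (hf0 : 0 ≤ f) (hfi : ∀ i, Integrable f (μs i : Measure Ω))
    {a : ℝ} (ha : a < ∫ x, f x ∂(μ : Measure Ω)) :
    ∀ᶠ i in l, a < ∫ x, f x ∂(μs i : Measure Ω) := by
  rcases lt_or_ge a 0 with ha0 | ha0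
  · exact Eventually.of_forall fun i => ha0.trans_le (integral_nonneg hf0)
  have hcoe : ∀ ρ : Measure Ω, ∫ x, f x ∂ρ = (∫⁻ x, (f x).toNNReal ∂ρ).toReal := fun ρ =>
    integral_eq_lintegral_of_nonneg_ae (ae_of_all _ hf0) hf.aestronglyMeasurable
  have hne : ∀ i, ∫⁻ x, (f x).toNNReal ∂(μs i : Measure Ω) ≠ ∞ := fun i =>
    ((lintegral_ofReal_le_lintegral_enorm f).trans_lt (hfi i).2).ne
  rw [hcoe] at ha
  -- An infinite lower integral under `μ` would be read as `0` by `toReal`, contradicting `0 ≤ a < ∫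
  -- f`.
  have ha' := (ENNReal.ofReal_lt_iff_lt_toReal ha0
    (fun h0 => by rw [h0] at ha; exact (ha0.trans_lt ha).false.elim)).2 ha
  filter_upwards [eventually_lt_lintegral h (f := fun x => (f x).toNNReal) (by fun_prop) ha']
    with i hi
  rw [hcoe]
  exact (ENNReal.ofReal_lt_iff_lt_toReal ha0 (hne i)).1 hi

/-- Convergence of the integral along a weakly convergent family, for a continuous function
dominated by a continuous function whose integrals converge. -/
theorem tendsto_integral_of_abs_le (h : Tendsto μs l (𝓝 μ)) {f H : Ω → ℝ} (hf : Continuous f)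
    (hH : Continuous H) (hfH : ∀ x, |f x| ≤ H x) (hHs : ∀ i, Integrable H (μs i : Measure Ω))
    (hHi : Integrable H (μ : Measure Ω))
    (hlim : Tendsto (fun i => ∫ x, H x ∂(μs i : Measure Ω)) l (𝓝 (∫ x, H x ∂(μ : Measure Ω)))) :
    Tendsto (fun i => ∫ x, f x ∂(μs i : Measure Ω)) l (𝓝 (∫ x, f x ∂(μ : Measure Ω))) := by
  have hint : ∀ ρ : Measure Ω, Integrable H ρ → Integrable f ρ := fun ρ hρ =>
    hρ.mono' hf.aestronglyMeasurable (ae_of_all _ hfH)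
  -- Lower semicontinuity for the non-negative function `H + g`, minus the convergence of `∫ H`,
  -- bounds `∫ g` from below; `g = f` and `g = -f` give the two halves.
  have key : ∀ g : Ω → ℝ, Continuous g → (∀ x, |g x| ≤ H x) → ∀ δ > 0, ∀ᶠ i in l,
      ∫ x, g x ∂(μ : Measure Ω) - δ < ∫ x, g x ∂(μs i : Measure Ω) := by
    intro g hg hgH δ hδ
    have hgi : ∀ ρ : Measure Ω, Integrable H ρ → Integrable g ρ := fun ρ hρ =>
      hρ.mono' hg.aestronglyMeasurable (ae_of_all _ hgH)
    have h1 := eventually_lt_integral h (f := fun x => H x + g x) (by fun_prop)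
      (fun x => by have := (abs_le.1 (hgH x)).1; simp only [Pi.zero_apply]; linarith)
      (fun i => (hHs i).add (hgi _ (hHs i)))
      (a := ∫ x, (H x + g x) ∂(μ : Measure Ω) - δ / 2) (by linarith)
    have h2 := hlim.eventually_lt_const (show _ < ∫ x, H x ∂(μ : Measure Ω) + δ / 2 by linarith)
    filter_upwards [h1, h2] with i hi1 hi2
    rw [integral_add hHi (hgi _ hHi), integral_add (hHs i) (hgi _ (hHs i))] at hi1
    linarith
  refine tendsto_order.2 ⟨fun a ha => ?_, fun a ha => ?_⟩
  · filter_upwards [key f hf hfH _ (sub_pos.2 ha)] with i hi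
    linarith
  · filter_upwards [key (fun x => -f x) hf.neg (fun x => by rw [abs_neg]; exact hfH x) _
      (sub_pos.2 ha)] with i hi
    rw [integral_neg, integral_neg] at hi
    linarith

end Weak

/-! ### Wasserstein convergence tested on Lipschitz functions. -/

section Wasserstein

variable {B : Type*} [NormedAddCommGroup B] [MeasurableSpace B] [BorelSpace B]

/-- The easy half of Kantorovich duality: every coupling writes the difference as the integral of `f
x - f y`. For `K = 0` the bound can fail: measures of different mass have no coupling, so `W1 = ∞`,
while `0 * ∞ = 0`. -/
theorem enorm_integral_sub_le_W1 {μ ν : Measure B} {f : B → ℝ} {K : ℝ≥0} (hK : K ≠ 0)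
    (hf : LipschitzWith K f) (hμ : Integrable f μ) (hν : Integrable f ν) :
    ‖∫ x, f x ∂μ - ∫ x, f x ∂ν‖ₑ ≤ K * W1 μ ν := by
  have hK0 : (K : ℝ≥0∞) ≠ 0 := by simpa using hK
  simp only [W1, ENNReal.mul_iInf_of_ne hK0 ENNReal.coe_ne_top]
  refine le_iInf₂ fun π hπ => ?_
  obtain ⟨rfl, rfl⟩ := hπ
  have hfm : ∀ ρ : Measure B, AEStronglyMeasurable f ρ :=
    fun ρ => hf.continuous.aestronglyMeasurable
  have h1 : Integrable (fun p : B × B => f p.1) π := hμ.comp_measurable measurable_fst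
  have h2 : Integrable (fun p : B × B => f p.2) π := hν.comp_measurable measurable_snd
  rw [integral_map measurable_fst.aemeasurable (hfm _),
    integral_map measurable_snd.aemeasurable (hfm _), ← integral_sub h1 h2,
    ← lintegral_const_mul' _ _ ENNReal.coe_ne_top]
  refine (enorm_integral_le_lintegral_enorm _).trans (lintegral_mono fun p => ?_)
  rw [← edist_eq_enorm_sub]
  exact hf p.1 p.2

theorem tendsto_integral_of_tendsto_W1 {ι : Type*} {l : Filter ι} {μs : ι → Measure B}
    {μ : Measure B} (h : Tendsto (fun i => W1 (μs i) μ) l (𝓝 0)) {f : B → ℝ} {K : ℝ≥0}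
    (hf : LipschitzWith K f) (hμs : ∀ i, Integrable f (μs i)) (hμ : Integrable f μ) :
    Tendsto (fun i => ∫ x, f x ∂(μs i)) l (𝓝 (∫ x, f x ∂μ)) := by
  rw [tendsto_iff_edist_tendsto_0]
  -- `K + 1` instead of `K` keeps the Lipschitz constant nonzero.
  have h0 : Tendsto (fun i => ((K + 1 : ℝ≥0) : ℝ≥0∞) * W1 (μs i) μ) l (𝓝 0) := by
    simpa using ENNReal.Tendsto.const_mul h (Or.inr (by simp))
  refine tendsto_of_tendsto_of_tendsto_of_le_of_le tendsto_const_nhds h0 (fun _ => zero_le)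
    fun i => ?_
  rw [edist_eq_enorm_sub]
  exact enorm_integral_sub_le_W1 (by positivity) (hf.weaken (by simp)) (hμs i) hμ

/-- Convergence in the Wasserstein distance implies weak convergence. -/
theorem tendsto_of_tendsto_W1 {ι : Type*} {l : Filter ι} [l.IsCountablyGenerated]
    {μs : ι → ProbabilityMeasure B} {μ : ProbabilityMeasure B}
    (h : Tendsto (fun i => W1 (μs i : Measure B) (μ : Measure B)) l (𝓝 0)) :
    Tendsto μs l (𝓝 μ) := by
  rw [tendsto_iff_forall_lipschitz_integral_tendsto]
  rintro f hb ⟨K, hK⟩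
  let g : B →ᵇ ℝ := ⟨⟨f, hK.continuous⟩, hb⟩
  exact tendsto_integral_of_tendsto_W1 h hK (fun i => g.integrable _) (g.integrable _)

theorem FiniteFirstMoment.integrable_norm [SecondCountableTopology B] {μ : Measure B}
    (h : FiniteFirstMoment μ) :
    Integrable (fun x => ‖x‖) μ :=
  Integrable.norm (f := fun x => x) ⟨continuous_id.aestronglyMeasurable, h⟩

end Wasserstein

end MOT

namespace MOT

/-! ### Limits of couplings and of martingale couplings. -/

section Couplings

variable {B : Type*} [NormedAddCommGroup B] [SecondCountableTopology B] [MeasurableSpace B]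
  [BorelSpace B]

theorem couplings.integrable_norm_fst {μ ν : Measure B} {π : Measure (B × B)}
    (hπ : π ∈ couplings μ ν) (hμ : FiniteFirstMoment μ) : Integrable (fun p => ‖p.1‖) π := by
  obtain ⟨rfl, rfl⟩ := hπ
  exact hμ.integrable_norm.comp_measurable measurable_fst

theorem couplings.integrable_norm_snd {μ ν : Measure B} {π : Measure (B × B)}
    (hπ : π ∈ couplings μ ν) (hν : FiniteFirstMoment ν) : Integrable (fun p => ‖p.2‖) π := by
  obtain ⟨rfl, rfl⟩ := hπ
  exact hν.integrable_norm.comp_measurable measurable_snd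

omit [SecondCountableTopology B] in
theorem couplings.integral_norm_fst {μ ν : Measure B} {π : Measure (B × B)}
    (hπ : π ∈ couplings μ ν) : ∫ p, ‖p.1‖ ∂π = ∫ x, ‖x‖ ∂μ := by
  rw [← hπ.1, integral_map measurable_fst.aemeasurable continuous_norm.aestronglyMeasurable]

omit [SecondCountableTopology B] in
theorem couplings.integral_norm_snd {μ ν : Measure B} {π : Measure (B × B)}
    (hπ : π ∈ couplings μ ν) : ∫ p, ‖p.2‖ ∂π = ∫ x, ‖x‖ ∂ν := by
  rw [← hπ.2, integral_map measurable_snd.aemeasurable continuous_norm.aestronglyMeasurable]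

variable {ι : Type*} {l : Filter ι} {μs νs : ι → Measure B} {μ ν : Measure B}
  {πs : ι → ProbabilityMeasure (B × B)} {π : ProbabilityMeasure (B × B)}

/-- Integrals of continuous functions of linear growth converge along weakly convergent couplings
whose marginals converge in the Wasserstein distance. -/
theorem tendsto_integral_couplings
    (hμs : ∀ i, FiniteFirstMoment (μs i)) (hνs : ∀ i, FiniteFirstMoment (νs i))
    (hμ : FiniteFirstMoment μ) (hν : FiniteFirstMoment ν)
    (hWμ : Tendsto (fun i => W1 (μs i) μ) l (𝓝 0)) (hWν : Tendsto (fun i => W1 (νs i) ν) l (𝓝 0))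
    (hπs : ∀ i, (πs i : Measure (B × B)) ∈ couplings (μs i) (νs i))
    (hπ : (π : Measure (B × B)) ∈ couplings μ ν) (h : Tendsto πs l (𝓝 π))
    {f : B × B → ℝ} (hf : Continuous f) {C : ℝ}
    (hfC : ∀ p, |f p| ≤ C * (1 + ‖p.1‖ + ‖p.2‖)) :
    Tendsto (fun i => ∫ p, f p ∂(πs i : Measure (B × B))) l
      (𝓝 (∫ p, f p ∂(π : Measure (B × B)))) := by
  have hint : ∀ {μ ν : Measure B} {π : ProbabilityMeasure (B × B)}, FiniteFirstMoment μ →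
      FiniteFirstMoment ν → (π : Measure (B × B)) ∈ couplings μ ν →
      Integrable (fun p => C * (1 + ‖p.1‖ + ‖p.2‖)) (π : Measure (B × B)) ∧
      ∫ p, C * (1 + ‖p.1‖ + ‖p.2‖) ∂(π : Measure (B × B))
        = C * (1 + ∫ x, ‖x‖ ∂μ + ∫ x, ‖x‖ ∂ν) := by
    intro μ ν π hμ hν hπ
    have h1 := couplings.integrable_norm_fst hπ hμ
    have h2 := couplings.integrable_norm_snd hπ hν
    have h01 : Integrable (fun p : B × B => 1 + ‖p.1‖) (π : Measure (B × B)) :=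
      (integrable_const (1 : ℝ)).add h1
    refine ⟨(h01.add h2).const_mul C, ?_⟩
    rw [integral_const_mul, integral_add h01 h2, integral_add (integrable_const _) h1,
      couplings.integral_norm_fst hπ, couplings.integral_norm_snd hπ]
    simp
  refine tendsto_integral_of_abs_le h hf (H := fun p => C * (1 + ‖p.1‖ + ‖p.2‖))
    (by fun_prop) hfC (fun i => (hint (hμs i) (hνs i) (hπs i)).1) (hint hμ hν hπ).1 ?_
  -- The dominating integral depends only on the marginals, and the norm is 1-Lipschitz, so `W1`
  -- convergence suffices.
  simp only [(hint hμ hν hπ).2, (hint (hμs _) (hνs _) (hπs _)).2]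
  have h1 := tendsto_integral_of_tendsto_W1 hWμ (lipschitzWith_one_norm (E := B))
    (fun i => (hμs i).integrable_norm) hμ.integrable_norm
  have h2 := tendsto_integral_of_tendsto_W1 hWν (lipschitzWith_one_norm (E := B))
    (fun i => (hνs i).integrable_norm) hν.integrable_norm
  exact ((h1.const_add 1).add h2).const_mul C

theorem tendsto_cost {c : B × B → ℝ≥0} (hc : Continuous c) (hgrowth : SublinearGrowth c)
    (hμs : ∀ i, FiniteFirstMoment (μs i)) (hνs : ∀ i, FiniteFirstMoment (νs i))
    (hμ : FiniteFirstMoment μ) (hν : FiniteFirstMoment ν)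
    (hWμ : Tendsto (fun i => W1 (μs i) μ) l (𝓝 0)) (hWν : Tendsto (fun i => W1 (νs i) ν) l (𝓝 0))
    (hπs : ∀ i, (πs i : Measure (B × B)) ∈ couplings (μs i) (νs i))
    (hπ : (π : Measure (B × B)) ∈ couplings μ ν) (h : Tendsto πs l (𝓝 π)) :
    Tendsto (fun i => cost c (πs i : Measure (B × B))) l (𝓝 (cost c (π : Measure (B × B)))) := by
  obtain ⟨C, hC⟩ := hgrowth
  have hbound : ∀ p : B × B, |(c p : ℝ)| ≤ C * (1 + ‖p.1‖ + ‖p.2‖) := fun p => by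
    rw [NNReal.abs_eq]; exact hC p.1 p.2
  have hcost : ∀ {μ ν : Measure B} {π : ProbabilityMeasure (B × B)}, FiniteFirstMoment μ →
      FiniteFirstMoment ν → (π : Measure (B × B)) ∈ couplings μ ν →
      cost c (π : Measure (B × B)) = ENNReal.ofReal (∫ p, (c p : ℝ) ∂(π : Measure (B × B))) := by
    intro μ ν π hμ hν hπ
    have hi : Integrable (fun p => (c p : ℝ)) (π : Measure (B × B)) := by
      refine Integrable.mono' ((((integrable_const (1 : ℝ)).add
        (couplings.integrable_norm_fst hπ hμ)).add
        (couplings.integrable_norm_snd hπ hν)).const_mul C) ?_ (ae_of_all _ hbound)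
      exact (NNReal.continuous_coe.comp hc).aestronglyMeasurable
    rw [ofReal_integral_eq_lintegral_ofReal hi (ae_of_all _ fun p => (c p).2)]
    simp [cost]
  simp only [hcost hμ hν hπ, hcost (hμs _) (hνs _) (hπs _)]
  exact (ENNReal.continuous_ofReal.tendsto _).comp (tendsto_integral_couplings hμs hνs hμ hν hWμ hWν
    hπs hπ h (NNReal.continuous_coe.comp hc) hbound)

/-- Weak limits of couplings are couplings of the weak limits of the marginals. -/
theorem mem_couplings_of_tendsto [l.NeBot] {μs νs : ι → ProbabilityMeasure B}
    {μ ν : ProbabilityMeasure B} (hμ : Tendsto μs l (𝓝 μ)) (hν : Tendsto νs l (𝓝 ν))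
    (hπs : ∀ i, (πs i : Measure (B × B)) ∈ couplings (μs i : Measure B) (νs i : Measure B))
    (h : Tendsto πs l (𝓝 π)) :
    (π : Measure (B × B)) ∈ couplings (μ : Measure B) (ν : Measure B) := by
  have hfst := ((ProbabilityMeasure.continuous_map (Ω := B × B) continuous_fst).tendsto π).comp h
  have hsnd := ((ProbabilityMeasure.continuous_map (Ω := B × B) continuous_snd).tendsto π).comp h
  have e1 := tendsto_nhds_unique hfst (hμ.congr fun i => Subtype.ext (hπs i).1.symm)
  have e2 := tendsto_nhds_unique hsnd (hν.congr fun i => Subtype.ext (hπs i).2.symm)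
  exact ⟨congrArg Subtype.val e1, congrArg Subtype.val e2⟩

variable [NormedSpace ℝ B]

theorem couplings.integrable_smul {μ ν : Measure B} {π : Measure (B × B)}
    (hμ : FiniteFirstMoment μ) (hν : FiniteFirstMoment ν) (hπ : π ∈ couplings μ ν) (g : B →ᵇ ℝ) :
    Integrable (fun p => g p.1 • (p.2 - p.1)) π := by
  have h1 : Integrable (fun p : B × B => p.1) π :=
    ⟨continuous_fst.aestronglyMeasurable,
      (hasFiniteIntegral_norm_iff _).1 (couplings.integrable_norm_fst hπ hμ).2⟩
  have h2 : Integrable (fun p : B × B => p.2) π :=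
    ⟨continuous_snd.aestronglyMeasurable,
      (hasFiniteIntegral_norm_iff _).1 (couplings.integrable_norm_snd hπ hν).2⟩
  exact (h2.sub h1).bdd_smul ‖g‖
    (g.continuous.comp continuous_fst).aestronglyMeasurable
    (ae_of_all _ fun p => g.norm_coe_le_norm p.1)

/-- Weak limits of martingale couplings are martingale couplings, provided that the marginals
converge in the Wasserstein distance. -/
theorem mem_martingaleCouplings_of_tendsto [CompleteSpace B] [l.NeBot]
    (hμs : ∀ i, FiniteFirstMoment (μs i)) (hνs : ∀ i, FiniteFirstMoment (νs i))
    (hμ : FiniteFirstMoment μ) (hν : FiniteFirstMoment ν)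
    (hWμ : Tendsto (fun i => W1 (μs i) μ) l (𝓝 0)) (hWν : Tendsto (fun i => W1 (νs i) ν) l (𝓝 0))
    (hπs : ∀ i, (πs i : Measure (B × B)) ∈ martingaleCouplings (μs i) (νs i))
    (hπ : (π : Measure (B × B)) ∈ couplings μ ν) (h : Tendsto πs l (𝓝 π)) :
    (π : Measure (B × B)) ∈ martingaleCouplings μ ν := by
  -- Testing against a continuous functional `φ` turns the Bochner integral into that of a scalar
  -- continuous function of linear growth, whose integrals along `πs` all vanish and converge.
  refine ⟨hπ, fun g => SeparatingDual.eq_zero_of_forall_dual_eq_zero (R := ℝ) fun φ => ?_⟩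
  rw [← φ.integral_comp_comm (couplings.integrable_smul hμ hν hπ g)]
  refine tendsto_nhds_unique (tendsto_integral_couplings hμs hνs hμ hν hWμ hWν
    (fun i => (hπs i).1) hπ h (f := fun p => φ (g p.1 • (p.2 - p.1)))
    (by fun_prop) (C := ‖φ‖ * ‖g‖) fun p => ?_) ?_
  · have h1 : ‖g p.1‖ ≤ ‖g‖ := g.norm_coe_le_norm p.1
    have h2 : ‖p.2 - p.1‖ ≤ 1 + ‖p.1‖ + ‖p.2‖ := by linarith [norm_sub_le p.2 p.1]
    calc |φ (g p.1 • (p.2 - p.1))| ≤ ‖φ‖ * (‖g p.1‖ * ‖p.2 - p.1‖) := by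
          rw [← norm_smul]; exact φ.le_opNorm _
      _ ≤ ‖φ‖ * (‖g‖ * (1 + ‖p.1‖ + ‖p.2‖)) := by gcongr
      _ = _ := by ring
  · refine tendsto_const_nhds.congr fun i => ?_
    rw [φ.integral_comp_comm (couplings.integrable_smul (hμs i) (hνs i) (hπs i).1 g),
      (hπs i).2 g, map_zero]

end Couplings

/-! ### Compactness and stability of the value. -/

section Stability

variable {B : Type*} [NormedAddCommGroup B] [NormedSpace ℝ B] [CompleteSpace B]
  [SecondCountableTopology B] [MeasurableSpace B] [BorelSpace B]

omit [NormedSpace ℝ B] in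
-- A convergent sequence together with its limit is compact, and on a complete separable space
-- compact sets of probability measures are tight.
theorem isTightMeasureSet_range {μs : ℕ → ProbabilityMeasure B} {μ : ProbabilityMeasure B}
    (h : Tendsto μs atTop (𝓝 μ)) :
    IsTightMeasureSet (Set.range fun n => (μs n : Measure B)) := by
  have hK := h.isCompact_insert_range
  have := isTightMeasureSet_of_isCompact_closure (by rwa [hK.isClosed.closure_eq])
  refine this.subset ?_
  rintro _ ⟨n, rfl⟩
  exact ⟨μs n, Or.inr ⟨n, rfl⟩, rfl⟩

omit [NormedSpace ℝ B] in
theorem isCompact_closure_range_couplings {μs νs : ℕ → ProbabilityMeasure B}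
    {μ ν : ProbabilityMeasure B} {πs : ℕ → ProbabilityMeasure (B × B)}
    (hμ : Tendsto μs atTop (𝓝 μ)) (hν : Tendsto νs atTop (𝓝 ν))
    (hπs : ∀ n, (πs n : Measure (B × B)) ∈ couplings (μs n : Measure B) (νs n : Measure B)) :
    IsCompact (closure (Set.range πs)) := by
  refine isCompact_closure_of_isTightMeasureSet (.prodMk ?_ ?_)
  · refine (isTightMeasureSet_range hμ).subset ?_
    rintro _ ⟨_, ⟨_, ⟨n, rfl⟩, rfl⟩, rfl⟩
    exact ⟨n, (hπs n).1.symm⟩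
  · refine (isTightMeasureSet_range hν).subset ?_
    rintro _ ⟨_, ⟨_, ⟨n, rfl⟩, rfl⟩, rfl⟩
    exact ⟨n, (hπs n).2.symm⟩

/-- Lower semicontinuity of the value of the martingale optimal transport problem. -/
theorem value_le_liminf {c : B × B → ℝ≥0} (hc : Continuous c)
    {μs νs : ℕ → ProbabilityMeasure B} {μ ν : ProbabilityMeasure B}
    (hμs : ∀ n, FiniteFirstMoment (μs n : Measure B))
    (hνs : ∀ n, FiniteFirstMoment (νs n : Measure B))
    (hμ : FiniteFirstMoment (μ : Measure B)) (hν : FiniteFirstMoment (ν : Measure B))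
    (hWμ : Tendsto (fun n => W1 (μs n : Measure B) (μ : Measure B)) atTop (𝓝 0))
    (hWν : Tendsto (fun n => W1 (νs n : Measure B) (ν : Measure B)) atTop (𝓝 0))
    (hne : ∀ n, ∃ π : ProbabilityMeasure (B × B),
      (π : Measure (B × B)) ∈ martingaleCouplings (μs n : Measure B) (νs n : Measure B)) :
    value c (μ : Measure B) (ν : Measure B)
      ≤ liminf (fun n => value c (μs n : Measure B) (νs n : Measure B)) atTop := by
  by_contra! hlt
  obtain ⟨r, hr, hr'⟩ := exists_between hlt
  have hfreq := frequently_lt_of_liminf_lt (by isBoundedDefault) hr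
  -- Near-optimal couplings where the value is below `r`; elsewhere any martingale coupling, so that
  -- the sequence is defined for every `n`.
  have hex : ∀ n, ∃ π : ProbabilityMeasure (B × B),
      (π : Measure (B × B)) ∈ martingaleCouplings (μs n : Measure B) (νs n : Measure B) ∧
      (value c (μs n : Measure B) (νs n : Measure B) < r → cost c (π : Measure (B × B)) < r) := by
    intro n
    by_cases h : value c (μs n : Measure B) (νs n : Measure B) < r
    · simp only [value, iInf_lt_iff] at h
      obtain ⟨π, hπ, hπr⟩ := h
      have : IsProbabilityMeasure (π.map Prod.fst) := by rw [hπ.1.1]; infer_instance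
      exact ⟨⟨π, Measure.isProbabilityMeasure_of_map Prod.fst⟩, hπ, fun _ => hπr⟩
    · obtain ⟨π, hπ⟩ := hne n
      exact ⟨π, hπ, fun h' => absurd h' h⟩
  choose σ hσ hσr using hex
  have hμw := tendsto_of_tendsto_W1 hWμ
  have hνw := tendsto_of_tendsto_W1 hWν
  have hK := isCompact_closure_range_couplings hμw hνw fun n => (hσ n).1
  have : NeBot (atTop ⊓ 𝓟 {n | value c (μs n : Measure B) (νs n : Measure B) < r}) :=
    frequently_mem_iff_neBot.1 hfreq
  -- The ultrafilter plays the role of a subsequence: it lives on the indices with value below `r`,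
  -- and by compactness `σ` converges along it.
  let U : Ultrafilter ℕ :=
    Ultrafilter.of (atTop ⊓ 𝓟 {n | value c (μs n : Measure B) (νs n : Measure B) < r})
  have hU : (U : Filter ℕ) ≤ atTop := (Ultrafilter.of_le _).trans inf_le_left
  have hUr : ∀ᶠ n in (U : Filter ℕ), value c (μs n : Measure B) (νs n : Measure B) < r :=
    (Ultrafilter.of_le _).trans inf_le_right (mem_principal_self _)
  obtain ⟨π, -, hπ⟩ := hK.ultrafilter_le_nhds (U.map σ) (by
    rw [le_principal_iff]
    exact mem_of_superset (range_mem_map) subset_closure)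
  have hπc := mem_couplings_of_tendsto (hμw.mono_left hU) (hνw.mono_left hU) (fun n => (hσ n).1) hπ
  have hπm := mem_martingaleCouplings_of_tendsto hμs hνs hμ hν (hWμ.mono_left hU)
    (hWν.mono_left hU) hσ hπc hπ
  have hle : cost c (π : Measure (B × B)) ≤ r :=
    (lintegral_le_liminf hπ hc).trans
      (liminf_le_of_frequently_le' (hUr.mono fun n hn => (hσr n hn).le).frequently)
  exact (((iInf₂_le _ hπm).trans hle).trans_lt hr').false

/-- Stability of the martingale optimal transport problem along a convergent sequence of martingale
couplings. -/
theorem stability {c : B × B → ℝ≥0} (hc : Continuous c) (hgrowth : SublinearGrowth c)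
    {μs νs : ℕ → ProbabilityMeasure B} {μ ν : ProbabilityMeasure B}
    {πs : ℕ → ProbabilityMeasure (B × B)} {π : ProbabilityMeasure (B × B)}
    (hμs : ∀ n, FiniteFirstMoment (μs n : Measure B))
    (hνs : ∀ n, FiniteFirstMoment (νs n : Measure B))
    (hμ : FiniteFirstMoment (μ : Measure B)) (hν : FiniteFirstMoment (ν : Measure B))
    (hWμ : Tendsto (fun n => W1 (μs n : Measure B) (μ : Measure B)) atTop (𝓝 0))
    (hWν : Tendsto (fun n => W1 (νs n : Measure B) (ν : Measure B)) atTop (𝓝 0))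
    (hπs : ∀ n, (πs n : Measure (B × B)) ∈
      martingaleCouplings (μs n : Measure B) (νs n : Measure B))
    (hπ : (π : Measure (B × B)) ∈ martingaleCouplings (μ : Measure B) (ν : Measure B))
    (h : Tendsto πs atTop (𝓝 π)) :
    (limsup (fun n => value c (μs n : Measure B) (νs n : Measure B)) atTop
        ≤ cost c (π : Measure (B × B)) ∧
      liminf (fun n => value c (μs n : Measure B) (νs n : Measure B)) atTop
        ≤ limsup (fun n => value c (μs n : Measure B) (νs n : Measure B)) atTop ∧
      value c (μ : Measure B) (ν : Measure B)
        ≤ liminf (fun n => value c (μs n : Measure B) (νs n : Measure B)) atTop) ∧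
    (IsOptimiser c (μ : Measure B) (ν : Measure B) (π : Measure (B × B)) →
      Tendsto (fun n => value c (μs n : Measure B) (νs n : Measure B)) atTop
        (𝓝 (value c (μ : Measure B) (ν : Measure B)))) := by
  have hcost := tendsto_cost hc hgrowth hμs hνs hμ hν hWμ hWν (fun n => (hπs n).1) hπ.1 h
  have hsup : limsup (fun n => value c (μs n : Measure B) (νs n : Measure B)) atTop
      ≤ cost c (π : Measure (B × B)) :=
    (limsup_le_limsup (Eventually.of_forall fun n => iInf₂_le _ (hπs n))).trans_eq hcost.limsup_eq
  have hinf := value_le_liminf hc hμs hνs hμ hν hWμ hWν fun n => ⟨πs n, hπs n⟩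
  exact ⟨⟨hsup, liminf_le_limsup, hinf⟩, fun hopt =>
    tendsto_of_le_liminf_of_limsup_le hinf (hsup.trans (le_iInf₂ hopt.2))⟩

end Stability

end MOT

namespace MOT

/-! ### Lévy's upward theorem in Banach spaces. -/

section Levy

variable {Ω E : Type*} {m mΩ : MeasurableSpace Ω} {P : Measure Ω} [IsFiniteMeasure P]
  [NormedAddCommGroup E] [NormedSpace ℝ E] [CompleteSpace E]

/-- The continuous linear map `t ↦ t • v` commutes with conditional expectation; this reduces
vector-valued indicators to the scalar Lévy theorem. -/
theorem condExp_indicator_const {s : Set Ω} (hs : MeasurableSet s) (v : E) :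
    P[s.indicator (fun _ => v) | m] =ᵐ[P] fun ω => (P[s.indicator (fun _ => (1 : ℝ)) | m]) ω • v := by
  have hi : Integrable (s.indicator fun _ => (1 : ℝ)) P := (integrable_const 1).indicator hs
  have h := (ContinuousLinearMap.toSpanSingleton ℝ v).comp_condExp_comm (m := m) hi
  have he : (ContinuousLinearMap.toSpanSingleton ℝ v) ∘ s.indicator (fun _ => (1 : ℝ))
      = s.indicator fun _ => v := by
    ext ω
    by_cases hω : ω ∈ s <;> simp [hω]
  rw [he] at h
  filter_upwards [h] with ω hω
  rw [← hω]
  simp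

/-- **Lévy's upward theorem** in `L¹` for functions with values in a Banach space. -/
theorem tendsto_eLpNorm_condExp_sub (ℱ : Filtration ℕ mΩ) {f : Ω → E} (hf : Integrable f P)
    (hfm : AEStronglyMeasurable[⨆ n, ℱ n] f P) :
    Tendsto (fun n => eLpNorm (P[f | ℱ n] - f) 1 P) atTop (𝓝 0) := by
  have hle : (⨆ n, ℱ n) ≤ mΩ := iSup_le ℱ.le
  -- The functions with the property include indicators by the scalar theorem, and are stable under
  -- disjoint sums, `L¹` limits and a.e. equality.
  refine MemLp.induction_stronglyMeasurable hle ENNReal.one_ne_top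
    (fun f => Tendsto (fun n => eLpNorm (P[f | ℱ n] - f) 1 P) atTop (𝓝 0)) ?_ ?_ ?_ ?_
    (memLp_one_iff_integrable.2 hf) hfm
  · intro v s hs _
    have hi : Integrable (s.indicator fun _ => (1 : ℝ)) P :=
      (integrable_const 1).indicator (hle s hs)
    have h := hi.tendsto_eLpNorm_condExp (ℱ := ℱ) (stronglyMeasurable_const.indicator hs)
    have h' := ENNReal.Tendsto.mul_const (b := ‖v‖ₑ) h (Or.inr enorm_ne_top)
    rw [zero_mul] at h'
    refine h'.congr fun n => ?_
    rw [eLpNorm_one_eq_lintegral_enorm, eLpNorm_one_eq_lintegral_enorm,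
      ← lintegral_mul_const' _ _ enorm_ne_top]
    refine lintegral_congr_ae ?_
    filter_upwards [condExp_indicator_const (P := P) (m := ℱ n) (hle s hs) v] with ω hω
    rw [Pi.sub_apply, Pi.sub_apply, hω, ← enorm_smul, sub_smul]
    by_cases hωs : ω ∈ s <;> simp [hωs]
  · intro f g _ hf hg _ _ hf0 hg0
    have hf' := memLp_one_iff_integrable.1 hf
    have hg' := memLp_one_iff_integrable.1 hg
    have h := hf0.add hg0
    rw [add_zero] at h
    refine tendsto_of_tendsto_of_tendsto_of_le_of_le tendsto_const_nhds h (fun _ => zero_le)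
      fun n => ?_
    refine le_trans (eLpNorm_congr_ae ?_).le (eLpNorm_add_le
      (integrable_condExp.sub hf').1 (integrable_condExp.sub hg').1 le_rfl)
    filter_upwards [condExp_add hf' hg' (ℱ n)] with ω hω
    simp only [Pi.sub_apply, hω, Pi.add_apply]
    abel
  · refine isClosed_of_closure_subset fun f hf => ?_
    refine ENNReal.tendsto_nhds_zero.2 fun ε hε => ?_
    have hε3 : 0 < ε / 3 := ENNReal.div_pos hε.ne' (by simp)
    obtain ⟨g, hg, hfg⟩ := EMetric.mem_closure_iff.1 hf _ hε3
    have hfg' : eLpNorm (⇑(f : Lp E 1 P) - ⇑(g : Lp E 1 P)) 1 P ≤ ε / 3 := by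
      rw [← Lp.edist_def]; exact hfg.le
    have hfi : Integrable (f : Lp E 1 P) P := L1.integrable_coeFn _
    have hgi : Integrable (g : Lp E 1 P) P := L1.integrable_coeFn _
    filter_upwards [ENNReal.tendsto_nhds_zero.1 hg _ hε3] with n hn
    -- The outer two terms are small because `g` is close to `f` and conditional expectation
    -- contracts `L¹`; the middle one because `g` has the property.
    have hsplit : P[⇑(f : Lp E 1 P) | ℱ n] - ⇑(f : Lp E 1 P) =ᵐ[P]
        P[(⇑(f : Lp E 1 P) - ⇑(g : Lp E 1 P)) | ℱ n]
          + (P[⇑(g : Lp E 1 P) | ℱ n] - ⇑(g : Lp E 1 P))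
          - (⇑(f : Lp E 1 P) - ⇑(g : Lp E 1 P)) := by
      filter_upwards [condExp_sub hfi hgi (ℱ n)] with ω hω
      simp only [Pi.sub_apply, Pi.add_apply, hω]
      abel
    calc eLpNorm (P[⇑(f : Lp E 1 P) | ℱ n] - ⇑(f : Lp E 1 P)) 1 P
        ≤ eLpNorm (P[(⇑(f : Lp E 1 P) - ⇑(g : Lp E 1 P)) | ℱ n]) 1 P
          + eLpNorm (P[⇑(g : Lp E 1 P) | ℱ n] - ⇑(g : Lp E 1 P)) 1 P
          + eLpNorm (⇑(f : Lp E 1 P) - ⇑(g : Lp E 1 P)) 1 P := by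
          rw [eLpNorm_congr_ae hsplit]
          have h2 := (integrable_condExp.sub hgi : Integrable (P[⇑(g : Lp E 1 P) | ℱ n] - ⇑(g : Lp E 1 P)) P).1
          refine (eLpNorm_sub_le (integrable_condExp.1.add h2) (hfi.sub hgi).1 le_rfl).trans ?_
          gcongr
          exact eLpNorm_add_le integrable_condExp.1 h2 le_rfl
      _ ≤ ε / 3 + ε / 3 + ε / 3 := by
          gcongr
          exact (eLpNorm_condExp_le_eLpNorm _ le_rfl).trans hfg'
      _ = ε := ENNReal.add_thirds ε
  · intro f g hfg _ hf0
    refine hf0.congr fun n => eLpNorm_congr_ae ?_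
    filter_upwards [hfg, condExp_congr_ae (m := ℱ n) hfg] with ω h1 h2
    simp only [Pi.sub_apply, h1, h2]

end Levy

/-! ### The σ-algebras generated by the partitions. -/

section SigmaAlgebras

variable {Ω B : Type*} [MeasurableSpace B] {Q : ℕ → Set (Set B)}

omit [MeasurableSpace B] in
theorem preimageSigma_eq_comap {X : Ω → B} (Q : Set (Set B)) :
    preimageSigma X Q = MeasurableSpace.comap X (MeasurableSpace.generateFrom Q) :=
  (MeasurableSpace.comap_generateFrom ..).symm

theorem IsGeneratingPartitions.preimageSigma_le (hQ : IsGeneratingPartitions Q) (X : Ω → B)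
    (n : ℕ) : preimageSigma X (Q n) ≤ MeasurableSpace.comap X inferInstance := by
  rw [preimageSigma_eq_comap]
  exact MeasurableSpace.comap_mono (MeasurableSpace.generateFrom_le (hQ.measurableSet n))

theorem IsGeneratingPartitions.preimageSigma_mono (hQ : IsGeneratingPartitions Q) (X : Ω → B) :
    Monotone fun n => preimageSigma X (Q n) :=
  monotone_nat_of_le_succ fun n => by
    simp only [preimageSigma_eq_comap]
    exact MeasurableSpace.comap_mono (hQ.refine_succ n)

theorem IsGeneratingPartitions.iSup_preimageSigma (hQ : IsGeneratingPartitions Q) (X : Ω → B) :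
    ⨆ n, preimageSigma X (Q n) = MeasurableSpace.comap X inferInstance := by
  simp only [preimageSigma_eq_comap, ← MeasurableSpace.comap_iSup]
  rw [MeasurableSpace.iSup_generateFrom, hQ.generate]

theorem IsGeneratingPartitions.sup_preimageSigma_le {mΩ : MeasurableSpace Ω}
    {Q₁ Q₂ : ℕ → Set (Set B)} {X Y : Ω → B} (hX : Measurable X) (hY : Measurable Y)
    (hQ₁ : IsGeneratingPartitions Q₁) (hQ₂ : IsGeneratingPartitions Q₂) (n : ℕ) :
    preimageSigma X (Q₁ n) ⊔ preimageSigma Y (Q₂ n) ≤ mΩ :=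
  sup_le ((hQ₁.preimageSigma_le X n).trans hX.comap_le)
    ((hQ₂.preimageSigma_le Y n).trans hY.comap_le)

end SigmaAlgebras

/-! ### Joint laws and the martingale property under conditioning. -/

section Laws

variable {Ω B : Type*} {m m₁ m₂ mΩ : MeasurableSpace Ω} [NormedAddCommGroup B]
  [SecondCountableTopology B] [MeasurableSpace B] [BorelSpace B]

/-- The joint law of `(U, V)` is a competitor in the infimum. -/
theorem W1_map_le {P : Measure Ω} {U V : Ω → B} (hU : Measurable U) (hV : Measurable V) :
    W1 (P.map U) (P.map V) ≤ eLpNorm (U - V) 1 P := by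
  have hUV : Measurable fun ω => (U ω, V ω) := hU.prodMk hV
  refine (iInf₂_le (P.map fun ω => (U ω, V ω)) ⟨?_, ?_⟩).trans_eq ?_
  · rw [lintegral_map (by fun_prop) hUV, eLpNorm_one_eq_lintegral_enorm]
    simp only [edist_eq_enorm_sub, Pi.sub_apply]
  · rw [Measure.map_map measurable_fst hUV]; rfl
  · rw [Measure.map_map measurable_snd hUV]; rfl

theorem finiteFirstMoment_map_iff {P : Measure Ω} {U : Ω → B} (hU : Measurable U) :
    FiniteFirstMoment (P.map U) ↔ Integrable U P := by
  rw [FiniteFirstMoment, lintegral_map (by fun_prop) hU]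
  exact ⟨fun h => ⟨hU.aestronglyMeasurable, h⟩, fun h => h.2⟩

variable [NormedSpace ℝ B]

theorem integral_smul_map {P : Measure Ω} {X Y : Ω → B} (hX : Measurable X) (hY : Measurable Y)
    (g : B →ᵇ ℝ) :
    ∫ p, g p.1 • (p.2 - p.1) ∂(P.map fun ω => (X ω, Y ω)) = ∫ ω, g (X ω) • (Y ω - X ω) ∂P :=
  integral_map (hX.prodMk hY).aemeasurable (by
    have := g.continuous
    exact Continuous.aestronglyMeasurable (by fun_prop))

omit [SecondCountableTopology B] in
/-- The martingale property tested against indicators of Borel sets. -/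
theorem setIntegral_preimage_eq_zero {P : Measure Ω} {X D : Ω → B} (hX : Measurable X)
    (hD : Integrable D P) (h : ∀ g : B →ᵇ ℝ, ∫ ω, g (X ω) • D ω ∂P = 0)
    {A : Set B} (hA : MeasurableSet A) : ∫ ω in X ⁻¹' A, D ω ∂P = 0 := by
  have hgen : ‹MeasurableSpace B› = MeasurableSpace.generateFrom {s | IsClosed s} :=
    BorelSpace.measurable_eq.trans borel_eq_generateFrom_isClosed
  induction A, hA using MeasurableSpace.induction_on_inter hgen isPiSystem_isClosed with
  | empty => simp
  | basic F hF =>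
    replace hF : IsClosed F := hF
    rw [← integral_indicator (hX hF.measurableSet)]
    -- The indicator of the closed set `F` is a pointwise limit of continuous functions with values
    -- in `[0, 1]`; each of these integrates to zero against `D` by `h`, and `‖D‖` dominates.
    refine tendsto_nhds_unique (tendsto_integral_of_dominated_convergence (fun ω => ‖D ω‖)
      (F := fun n ω => ((hF.apprSeq n (X ω) : ℝ≥0) : ℝ) • D ω) ?_ hD.norm ?_ ?_)
      (tendsto_const_nhds.congr fun n => ?_)
    · intro n
      exact ((hF.apprSeq n).continuous.measurable.comp hX).coe_nnreal_real.aestronglyMeasurable.smul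
        hD.1
    · refine fun n => ae_of_all _ fun ω => ?_
      rw [norm_smul, Real.norm_of_nonneg (NNReal.coe_nonneg _)]
      exact mul_le_of_le_one_left (norm_nonneg _) (HasOuterApproxClosed.apprSeq_apply_le_one hF n _)
    · refine ae_of_all _ fun ω => ?_
      have := tendsto_pi_nhds.1 (HasOuterApproxClosed.tendsto_apprSeq hF) (X ω)
      have h' := ((NNReal.continuous_coe.tendsto _).comp this).smul_const (D ω)
      by_cases hω : X ω ∈ F <;> simpa [hω, Set.indicator] using h'
    · refine (h ((hF.apprSeq n).comp _ NNReal.isometry_coe.lipschitz)).symm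
  | compl A hA ih =>
    have h1 : ∫ ω, D ω ∂P = 0 := by simpa using h 1
    have := integral_add_compl (hX hA) hD
    rw [ih, h1, zero_add] at this
    exact this
  | iUnion f hd hf ih =>
    rw [Set.preimage_iUnion, integral_iUnion (fun i => hX (hf i))
      (fun i j hij => (hd hij).preimage X) hD.integrableOn]
    simp [ih]

variable [CompleteSpace B]

omit [SecondCountableTopology B] in
-- Every set of `m` has the form `X⁻¹(A)` with `A` Borel, and `D` integrates to zero over such sets.
theorem condExp_sub_eq_zero {P : Measure Ω} [IsFiniteMeasure P] {X D : Ω → B} (hX : Measurable X)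
    (hD : Integrable D P) (h : ∀ g : B →ᵇ ℝ, ∫ ω, g (X ω) • D ω ∂P = 0)
    (hm : m ≤ MeasurableSpace.comap X inferInstance) :
    P[D | m] =ᵐ[P] 0 := by
  refine (ae_eq_condExp_of_forall_setIntegral_eq (hm.trans hX.comap_le) hD
    (fun _ _ _ => integrableOn_zero) (fun s hs _ => ?_)
    aestronglyMeasurable_zero).symm
  obtain ⟨A, hA, rfl⟩ := hm s hs
  rw [setIntegral_preimage_eq_zero hX hD h hA]
  simp

/-- Conditioning a martingale pair on nested σ-algebras gives a martingale pair. -/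
theorem map_condExp_mem_martingaleCouplings {P : Measure Ω} [IsFiniteMeasure P] {X Y : Ω → B}
    (hX : Integrable X P) (hY : Integrable Y P) (h12 : m₁ ≤ m₂)
    (h2 : m₂ ≤ mΩ) (h : P[Y - X | m₁] =ᵐ[P] 0) :
    P.map (fun ω => ((P[X | m₁]) ω, (P[Y | m₂]) ω)) ∈
      martingaleCouplings (P.map (P[X | m₁])) (P.map (P[Y | m₂])) := by
  have hXm : StronglyMeasurable[m₁] (P[X | m₁]) := stronglyMeasurable_condExp
  have hX' : Measurable (P[X | m₁]) := (hXm.mono (h12.trans h2)).measurable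
  have hY' : Measurable (P[Y | m₂]) := (stronglyMeasurable_condExp.mono h2).measurable
  refine ⟨⟨?_, ?_⟩, fun g => ?_⟩
  · rw [Measure.map_map measurable_fst (hX'.prodMk hY')]; rfl
  · rw [Measure.map_map measurable_snd (hX'.prodMk hY')]; rfl
  rw [integral_smul_map hX' hY']
  have hD : Integrable (P[Y | m₂] - P[X | m₁]) P := integrable_condExp.sub integrable_condExp
  have hg : StronglyMeasurable[m₁] fun ω => g ((P[X | m₁]) ω) :=
    g.continuous.comp_stronglyMeasurable hXm
  have hgD : Integrable ((fun ω => g ((P[X | m₁]) ω)) • (P[Y | m₂] - P[X | m₁])) P :=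
    hD.bdd_smul ‖g‖ (hg.mono (h12.trans h2)).aestronglyMeasurable
      (ae_of_all _ fun ω => g.norm_coe_le_norm _)
  -- By the tower property the left side equals `P[Y - X | m₁]`. The factor `g(P[X | m₁])` is
  -- `m₁`-measurable and can then be pulled out below.
  have hzero : P[P[Y | m₂] - P[X | m₁] | m₁] =ᵐ[P] 0 := by
    filter_upwards [condExp_sub (integrable_condExp (f := Y) (m := m₂) (μ := P))
      (integrable_condExp (f := X) (m := m₁) (μ := P)) m₁,
      condExp_condExp_of_le (f := Y) (μ := P) h12 h2,
      condExp_condExp_of_le (f := X) (μ := P) le_rfl (h12.trans h2),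
      condExp_sub hY hX m₁, h] with ω e1 e2 e3 e4 e5
    rw [e1, Pi.sub_apply, e2, e3, ← Pi.sub_apply, ← e4, e5]
  calc ∫ ω, g ((P[X | m₁]) ω) • ((P[Y | m₂]) ω - (P[X | m₁]) ω) ∂P
      = ∫ ω, (P[(fun ω => g ((P[X | m₁]) ω)) • (P[Y | m₂] - P[X | m₁]) | m₁]) ω ∂P :=
        (integral_condExp (h12.trans h2)).symm
    _ = ∫ ω, (0 : B) ∂P := by
        refine integral_congr_ae ?_
        filter_upwards [condExp_smul_of_aestronglyMeasurable_left hg.aestronglyMeasurable hgD hD,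
          hzero] with ω h1 h2
        rw [h1, Pi.smul_apply', h2, Pi.zero_apply, smul_zero]
    _ = 0 := integral_zero _ _

end Laws

/-! ### `L¹` convergence of the quantisations. -/

section Quantisation

variable {Ω B : Type*} {mΩ : MeasurableSpace Ω} [NormedAddCommGroup B] [NormedSpace ℝ B]
  [CompleteSpace B] [SecondCountableTopology B] [MeasurableSpace B] [BorelSpace B]
  {P : Measure Ω} {X Y : Ω → B} {Q₁ Q₂ : ℕ → Set (Set B)}

omit [SecondCountableTopology B] in
theorem measurable_quantX (hX : Measurable X) (hQ₁ : IsGeneratingPartitions Q₁) (n : ℕ) :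
    Measurable (quantX P X (Q₁ n)) :=
  (stronglyMeasurable_condExp.mono
    ((hQ₁.preimageSigma_le X n).trans hX.comap_le)).measurable

omit [SecondCountableTopology B] in
theorem measurable_quantY (hX : Measurable X) (hY : Measurable Y)
    (hQ₁ : IsGeneratingPartitions Q₁) (hQ₂ : IsGeneratingPartitions Q₂) (n : ℕ) :
    Measurable (quantY P X Y (Q₁ n) (Q₂ n)) :=
  (stronglyMeasurable_condExp.mono (hQ₁.sup_preimageSigma_le hX hY hQ₂ n)).measurable

theorem tendsto_eLpNorm_quantX [IsFiniteMeasure P] (hX : Measurable X) (hXi : Integrable X P)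
    (hQ₁ : IsGeneratingPartitions Q₁) :
    Tendsto (fun n => eLpNorm (quantX P X (Q₁ n) - X) 1 P) atTop (𝓝 0) := by
  refine tendsto_eLpNorm_condExp_sub ⟨fun n => preimageSigma X (Q₁ n),
    hQ₁.preimageSigma_mono X, fun n => (hQ₁.preimageSigma_le X n).trans hX.comap_le⟩ hXi ?_
  refine StronglyMeasurable.aestronglyMeasurable ?_
  change StronglyMeasurable[⨆ n, preimageSigma X (Q₁ n)] X
  rw [hQ₁.iSup_preimageSigma X]
  exact (comap_measurable X).stronglyMeasurable

theorem tendsto_eLpNorm_quantY [IsFiniteMeasure P] (hX : Measurable X) (hY : Measurable Y)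
    (hYi : Integrable Y P) (hQ₁ : IsGeneratingPartitions Q₁) (hQ₂ : IsGeneratingPartitions Q₂) :
    Tendsto (fun n => eLpNorm (quantY P X Y (Q₁ n) (Q₂ n) - Y) 1 P) atTop (𝓝 0) := by
  refine tendsto_eLpNorm_condExp_sub ⟨fun n => preimageSigma X (Q₁ n) ⊔ preimageSigma Y (Q₂ n),
    fun i j hij => sup_le_sup (hQ₁.preimageSigma_mono X hij) (hQ₂.preimageSigma_mono Y hij),
    hQ₁.sup_preimageSigma_le hX hY hQ₂⟩ hYi ?_
  refine StronglyMeasurable.aestronglyMeasurable ?_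
  change StronglyMeasurable[⨆ n, preimageSigma X (Q₁ n) ⊔ preimageSigma Y (Q₂ n)] Y
  -- The partitions pulled back by `Y` alone generate `σ(Y)`; those pulled back by `X` serve the
  -- nesting behind the martingale property.
  have hle : MeasurableSpace.comap Y inferInstance
      ≤ ⨆ n, preimageSigma X (Q₁ n) ⊔ preimageSigma Y (Q₂ n) := by
    rw [← hQ₂.iSup_preimageSigma Y]
    exact iSup_mono fun n => le_sup_right
  exact (Measurable.mono (comap_measurable Y) hle le_rfl).stronglyMeasurable

end Quantisation

end MOT

theorem mainTheorem7 {B : Type*} [NormedAddCommGroup B] [NormedSpace ℝ B] [CompleteSpace B]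
    [SecondCountableTopology B] [MeasurableSpace B] [BorelSpace B]
    (c : B × B → ℝ≥0) (hc : Continuous c) (hgrowth : MOT.SublinearGrowth c)
    (μ ν : ProbabilityMeasure B)
    (hμ : MOT.FiniteFirstMoment (μ : Measure B)) (hν : MOT.FiniteFirstMoment (ν : Measure B))
    (π : ProbabilityMeasure (B × B))
    (hπ : (π : Measure (B × B)) ∈ MOT.martingaleCouplings (μ : Measure B) (ν : Measure B)) :
    -- arbitrary martingale couplings `πs n` of `μs n`, `νs n` converging to `π`
    (∀ (μs νs : ℕ → ProbabilityMeasure B) (πs : ℕ → ProbabilityMeasure (B × B)),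
      (∀ n, MOT.FiniteFirstMoment (μs n : Measure B)) →
      (∀ n, MOT.FiniteFirstMoment (νs n : Measure B)) →
      Tendsto (fun n => MOT.W1 (μs n : Measure B) (μ : Measure B)) atTop (𝓝 0) →
      Tendsto (fun n => MOT.W1 (νs n : Measure B) (ν : Measure B)) atTop (𝓝 0) →
      (∀ n, (πs n : Measure (B × B)) ∈
        MOT.martingaleCouplings (μs n : Measure B) (νs n : Measure B)) →
      Tendsto πs atTop (𝓝 π) →
      (limsup (fun n => MOT.value c (μs n : Measure B) (νs n : Measure B)) atTop
          ≤ MOT.cost c (π : Measure (B × B)) ∧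
        liminf (fun n => MOT.value c (μs n : Measure B) (νs n : Measure B)) atTop
          ≤ limsup (fun n => MOT.value c (μs n : Measure B) (νs n : Measure B)) atTop ∧
        MOT.value c (μ : Measure B) (ν : Measure B)
          ≤ liminf (fun n => MOT.value c (μs n : Measure B) (νs n : Measure B)) atTop) ∧
      (MOT.IsOptimiser c (μ : Measure B) (ν : Measure B) (π : Measure (B × B)) →
        Tendsto (fun n => MOT.value c (μs n : Measure B) (νs n : Measure B)) atTop
          (𝓝 (MOT.value c (μ : Measure B) (ν : Measure B))))) ∧
    -- in particular, the martingale quantisations of any `(X, Y)` with law `π`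
    (∀ (Ω : Type*) [MeasurableSpace Ω] (P : Measure Ω) [IsProbabilityMeasure P] (X Y : Ω → B)
      (Q₁ Q₂ : ℕ → Set (Set B)),
      Measurable X → Measurable Y →
      P.map (fun ω => (X ω, Y ω)) = (π : Measure (B × B)) →
      MOT.IsGeneratingPartitions Q₁ → MOT.IsGeneratingPartitions Q₂ →
      ∀ Pn : ℕ → ℝ≥0∞,
      (∀ n, Pn n = MOT.value c (P.map (MOT.quantX P X (Q₁ n)))
        (P.map (MOT.quantY P X Y (Q₁ n) (Q₂ n)))) →
      (limsup Pn atTop ≤ MOT.cost c (π : Measure (B × B)) ∧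
        liminf Pn atTop ≤ limsup Pn atTop ∧
        MOT.value c (μ : Measure B) (ν : Measure B) ≤ liminf Pn atTop) ∧
      (MOT.IsOptimiser c (μ : Measure B) (ν : Measure B) (π : Measure (B × B)) →
        Tendsto Pn atTop (𝓝 (MOT.value c (μ : Measure B) (ν : Measure B))))) := by
  refine ⟨fun μs νs πs hμs hνs hWμ hWν hπs h =>
    MOT.stability hc hgrowth hμs hνs hμ hν hWμ hWν hπs hπ h, ?_⟩
  intro Ω _ P _ X Y Q₁ Q₂ hX hY hlaw hQ₁ hQ₂ Pn hPn
  have hXlaw : P.map X = μ := by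
    rw [← hπ.1.1, ← hlaw, Measure.map_map measurable_fst (hX.prodMk hY)]
    rfl
  have hYlaw : P.map Y = ν := by
    rw [← hπ.1.2, ← hlaw, Measure.map_map measurable_snd (hX.prodMk hY)]
    rfl
  have hXi : Integrable X P := (MOT.finiteFirstMoment_map_iff hX).1 (hXlaw ▸ hμ)
  have hYi : Integrable Y P := (MOT.finiteFirstMoment_map_iff hY).1 (hYlaw ▸ hν)
  have hXn := fun n => MOT.measurable_quantX (P := P) hX hQ₁ n
  have hYn := fun n => MOT.measurable_quantY (P := P) hX hY hQ₁ hQ₂ n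
  have hXlim := MOT.tendsto_eLpNorm_quantX hX hXi hQ₁
  have hYlim := MOT.tendsto_eLpNorm_quantY hX hY hYi hQ₁ hQ₂
  let μs : ℕ → ProbabilityMeasure B := fun n =>
    ⟨P.map (MOT.quantX P X (Q₁ n)), Measure.isProbabilityMeasure_map (hXn n).aemeasurable⟩
  let νs : ℕ → ProbabilityMeasure B := fun n =>
    ⟨P.map (MOT.quantY P X Y (Q₁ n) (Q₂ n)),
      Measure.isProbabilityMeasure_map (hYn n).aemeasurable⟩
  let πs : ℕ → ProbabilityMeasure (B × B) := fun n =>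
    ⟨P.map fun ω => (MOT.quantX P X (Q₁ n) ω, MOT.quantY P X Y (Q₁ n) (Q₂ n) ω),
      Measure.isProbabilityMeasure_map ((hXn n).prodMk (hYn n)).aemeasurable⟩
  have hWμ : Tendsto (fun n => MOT.W1 (μs n : Measure B) (μ : Measure B)) atTop (𝓝 0) :=
    tendsto_of_tendsto_of_tendsto_of_le_of_le tendsto_const_nhds hXlim (fun _ => zero_le)
      fun n => hXlaw ▸ MOT.W1_map_le (hXn n) hX
  have hWν : Tendsto (fun n => MOT.W1 (νs n : Measure B) (ν : Measure B)) atTop (𝓝 0) :=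
    tendsto_of_tendsto_of_tendsto_of_le_of_le tendsto_const_nhds hYlim (fun _ => zero_le)
      fun n => hYlaw ▸ MOT.W1_map_le (hYn n) hY
  have hlim := hXlim.add hYlim
  rw [add_zero] at hlim
  have hπlim : Tendsto πs atTop (𝓝 π) := by
    refine MOT.tendsto_of_tendsto_W1 (tendsto_of_tendsto_of_tendsto_of_le_of_le
      tendsto_const_nhds hlim (fun _ => zero_le) fun n => ?_)
    rw [← hlaw]
    -- The product carries the maximum norm, and a maximum is at most the sum, so the two `L¹`
    -- distances bound `W1` of the joint laws.
    refine (MOT.W1_map_le ((hXn n).prodMk (hYn n)) (hX.prodMk hY)).trans ?_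
    simp only [eLpNorm_one_eq_lintegral_enorm]
    rw [← lintegral_add_left ((hXn n).sub hX).enorm]
    refine lintegral_mono fun ω => ?_
    simp only [Pi.sub_apply, ← edist_eq_enorm_sub, Prod.edist_eq]
    exact max_le le_self_add le_add_self
  -- The martingale property of `π`, carried back to `Ω`, gives zero conditional expectation on
  -- every σ-algebra inside `σ(X)`.
  have hzero : ∀ n, P[Y - X | MOT.preimageSigma X (Q₁ n)] =ᵐ[P] 0 := fun n =>
    MOT.condExp_sub_eq_zero hX (hYi.sub hXi)
      (fun g => (MOT.integral_smul_map hX hY g).symm.trans (hlaw ▸ hπ.2 g))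
      (hQ₁.preimageSigma_le X n)
  obtain rfl : Pn = fun n => MOT.value c (μs n : Measure B) (νs n : Measure B) := funext hPn
  exact MOT.stability hc hgrowth
    (fun n => (MOT.finiteFirstMoment_map_iff (hXn n)).2 integrable_condExp)
    (fun n => (MOT.finiteFirstMoment_map_iff (hYn n)).2 integrable_condExp) hμ hν hWμ hWν
    (πs := πs) (fun n => MOT.map_condExp_mem_martingaleCouplings hXi hYi le_sup_left
      (hQ₁.sup_preimageSigma_le hX hY hQ₂ n) (hzero n)) hπ hπlim
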